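/- Let $n\ge 1$, $0<s<1$ and $1<p<\infty$ with $sp<n$, and let $G\subsetneq\mathbb{R}^n$ be a (non-empty, proper) uniform domain. That is, $G$ is open and connected, and there is a constant $C_1\ge 1$ such that every pair of points $x,y\in G$ can be joined by a curve $\gamma\colon[0,\ell]\to G$, parameterized by arc length, with $\ell\le C_1|x-y|$ and $\operatorname{dist}(z,\partial G)\ge \frac1{C_1}\min\{|z-x|,|z-y|\}$ for each point $z$ on $\gamma$. For $\lambda>0$ and $E\subset\mathbb{R}^n$ let $$\mathcal{H}^\lambda_\infty(E)=\inf\Big\{\sum_{i=1}^\infty r_i^\lambda : E\subset\bigcup_{i=1}^\infty B(x_i,r_i),\ r_i>0\Big\}$$ be the $\lambda$-Hausdorff content, where $B(x,r)$ denotes the open ball. Assume that there exist $\lambda$ with $n-sp<\lambda\le n$ and $C>0$ such that $$\mathcal{H}^\lambda_\infty\big(B(x,2\operatorname{dist}(x,\partial G))\cap\partial G\big)\ge C\operatorname{dist}(x,\partial G)^\lambda\qquad\text{for all } x\in G.$$ Then $G$ admits an $(s,p)$-Hardy inequality, i.e. there is a constant $c>0$ such that $$\int_G\frac{|u(x)|^p}{\operatorname{dist}(x,\partial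 G)^{sp}}\,dx\le c\int_G\int_G\frac{|u(x)-u(y)|^p}{|x-y|^{n+sp}}\,dy\,dx$$ for every $u\in C_0^\infty(G)$, i.e. for every (complex-valued) smooth function $u$ on $\mathbb{R}^n$ with compact support contained in $G$. -/

import Mathlib

open scoped ENNReal ContDiff

/-- The `lam`-Hausdorff content of a set `A`: the infimum of `∑ rᵢ ^ lam` over all countable
coverings of `A` by open balls `B(xᵢ, rᵢ)` with `rᵢ > 0`. -/
noncomputable def hausdorffContent {X : Type*} [PseudoMetricSpace X] (lam : ℝ) (A : Set X) :
    ℝ≥0∞ :=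
  ⨅ (x : ℕ → X) (r : ℕ → ℝ) (_ : ∀ i, 0 < r i) (_ : A ⊆ ⋃ i, Metric.ball (x i) (r i)),
    ∑' i, ENNReal.ofReal (r i ^ lam)

/-- A uniform domain: a nonempty connected open set `G` for which there is `C ≥ 1` such that any
two points `x, y ∈ G` are joined by a curve `γ : [0, ℓ] → G`, parameterized by arc length, with
`ℓ ≤ C |x - y|` and `dist (z, ∂G) ≥ (1 / C) min (|z - x|, |z - y|)` for every `z` on `γ`. -/
def IsUniformDomain {n : ℕ} (G : Set (EuclideanSpace ℝ (Fin n))) : Prop :=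
  IsOpen G ∧ IsConnected G ∧
    ∃ C : ℝ, 1 ≤ C ∧ ∀ x ∈ G, ∀ y ∈ G,
      ∃ (l : ℝ) (γ : ℝ → EuclideanSpace ℝ (Fin n)),
        0 ≤ l ∧ ContinuousOn γ (Set.Icc 0 l) ∧ HasUnitSpeedOn γ (Set.Icc 0 l) ∧
        Set.MapsTo γ (Set.Icc 0 l) G ∧ γ 0 = x ∧ γ l = y ∧
        l ≤ C * dist x y ∧
        ∀ t ∈ Set.Icc 0 l,
          1 / C * min (dist (γ t) x) (dist (γ t) y) ≤ Metric.infDist (γ t) (frontier G)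

/-- The inner boundary density condition with exponent `lam`: for some `C > 0`, the
`lam`-Hausdorff content of `B(x, 2 dist (x, ∂G)) ∩ ∂G` is at least `C dist (x, ∂G) ^ lam`
for all `x ∈ G`. -/
def InnerBoundaryDensity {n : ℕ} (G : Set (EuclideanSpace ℝ (Fin n))) (lam : ℝ) : Prop :=
  ∃ C : ℝ, 0 < C ∧ ∀ x ∈ G,
    ENNReal.ofReal (C * Metric.infDist x (frontier G) ^ lam) ≤
      hausdorffContent lam
        (Metric.ball x (2 * Metric.infDist x (frontier G)) ∩ frontier G)

/-- `G` admits an `(s, p)`-Hardy inequality: there is a (finite) constant `c > 0` such that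
`∫_G |u(x)|^p / dist (x, ∂G)^(s p) dx ≤ c ∫_G ∫_G |u(x) - u(y)|^p / |x - y|^(n + s p) dy dx`
for every smooth complex-valued `u` with compact support contained in `G`. Both sides are
integrals of nonnegative functions with values in `[0, ∞]`. -/
def AdmitsFractionalHardy {n : ℕ} (s p : ℝ) (G : Set (EuclideanSpace ℝ (Fin n))) : Prop :=
  ∃ c : ℝ, 0 < c ∧ ∀ u : EuclideanSpace ℝ (Fin n) → ℂ,
    ContDiff ℝ ∞ u → HasCompactSupport u → tsupport u ⊆ G →
      ∫⁻ x in G, ‖u x‖ₑ ^ p / ENNReal.ofReal (Metric.infDist x (frontier G)) ^ (s * p) ≤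
        ENNReal.ofReal c *
          ∫⁻ x in G, ∫⁻ y in G, ‖u x - u y‖ₑ ^ p / edist x y ^ ((n : ℝ) + s * p)

/-!
The fractional energy is nonlocal: averages of `u` over two balls `B` and `B'` in `G`, with radii
comparable to `r` and at distance at most a multiple of `r`, satisfy
`|u_B - u_B'|^p ≤ C r^(s p - n) ∫_B g`, where `g(y) = ∫_G |u(y) - u(z)|^p / |y - z|^(n + s p) dz`. No
chain of balls is needed, and of the uniformity of `G` only interior corkscrew points remain
(`IsUniformDomain.exists_hasInteriorCorkscrews`).

Write `d` for the distance to the boundary, fix `x ∈ G` and a boundary point `w` with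
`|x - w| < 2 d(x)`. The averages of `u` over corkscrew balls at the scales `r_k = 2^(-k) d(x)` near `w`
start with an average `m` over a ball centred at `x` and end with zero, because `u` vanishes near `w`.
Hence one of the increments is at least a constant times `2^(-k ε / p) |m|`. Since `d` is comparable to
`r_k` on the corkscrew ball, `g` may be replaced by `g (d / r_k)^ε` there, and with
`lam = n - s p + 2 ε` the outcome is
`|m|^p r_k^lam ≤ C d(x)^ε ∫_{B(w, 3 r_k) ∩ G} g d^ε`
(`HasInteriorCorkscrews.exists_radius_average_le`). A Vitali covering by such balls
(`mul_hausdorffContent_le_measure`) and the density of the boundary give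
`|m|^p d(x)^(-s p) ≤ C d(x)^(-n - ε) ∫_{B(x, 6 d(x)) ∩ G} g d^ε`
(`HasInteriorCorkscrews.exists_average_le_weightedEnergy`).

Integrated over `x ∈ G`, the right-hand side is at most `C ∫_G g`
(`exists_lintegral_weightedEnergy_le`); the weight `d^ε`, available because `lam` is strictly larger
than `n - s p`, makes the sum over scales converge, so that no maximal function is needed. The
deviation of `u(x)` from `m` is controlled by `g(x)` directly (`enorm_average_sub_rpow_le`).
-/

open MeasureTheory

/-! ### Hausdorff content and covering by disjoint balls -/

/-- Coverings indexed by any countable type bound the Hausdorff content. The definition uses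
coverings indexed by `ℕ` with positive radii, so the given covering is padded with infinitely many
balls whose radii have an arbitrarily small total `lam`-th power. -/
theorem hausdorffContent_le_tsum {X ι : Type*} [PseudoMetricSpace X] [Nonempty X] [Countable ι]
    {lam : ℝ} (hlam : 0 < lam) {A : Set X} (x : ι → X) (r : ι → ℝ) (hr : ∀ i, 0 < r i)
    (hA : A ⊆ ⋃ i, Metric.ball (x i) (r i)) :
    hausdorffContent lam A ≤ ∑' i, ENNReal.ofReal (r i ^ lam) := by
  refine ENNReal.le_of_forall_pos_le_add fun δ hδ _ ↦ ?_
  obtain ⟨η, hη, hηsum⟩ := ENNReal.exists_pos_sum_of_countable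
    (ENNReal.coe_ne_zero.2 hδ.ne') ℕ
  obtain ⟨e⟩ : Nonempty (ℕ ≃ ι ⊕ ℕ) := nonempty_equiv_of_countable
  obtain ⟨x₀⟩ := ‹Nonempty X›
  let x' : ι ⊕ ℕ → X := Sum.elim x fun _ ↦ x₀
  let r' : ι ⊕ ℕ → ℝ := Sum.elim r fun i ↦ (η i : ℝ) ^ lam⁻¹
  have hr' : ∀ i, 0 < r' i := by
    rintro (i | i)
    · exact hr i
    · exact Real.rpow_pos_of_pos (hη i) _
  calc hausdorffContent lam A
      ≤ ∑' i, ENNReal.ofReal (r' (e i) ^ lam) := by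
        refine iInf₂_le_of_le (fun i ↦ x' (e i)) (fun i ↦ r' (e i)) <|
          iInf₂_le_of_le (fun i ↦ hr' _) ?_ le_rfl
        refine hA.trans (Set.iUnion_subset fun i ↦ ?_)
        refine Set.subset_iUnion_of_subset (e.symm (Sum.inl i)) ?_
        simp [x', r']
    _ = ∑' i, ENNReal.ofReal (r' i ^ lam) := e.tsum_eq fun i ↦ ENNReal.ofReal (r' i ^ lam)
    _ = ∑' i, ENNReal.ofReal (r i ^ lam) + ∑' i, (η i : ℝ≥0∞) := by
        rw [Summable.tsum_sum ENNReal.summable ENNReal.summable]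
        congr 1
        refine tsum_congr fun i ↦ ?_
        simp only [r', Sum.elim_inr]
        rw [Real.rpow_inv_rpow (η i).coe_nonneg hlam.ne', ENNReal.ofReal_coe_nnreal]
    _ ≤ _ := by gcongr

/-- If every point of `A` is the centre of
a ball of radius `r w` whose `μ`-mass is at least `a * r w ^ lam`, then the content of `A` is
controlled by the mass of a set containing all these balls. The Vitali covering lemma extracts
disjoint balls whose fivefold enlargements cover `A`; open balls of six times the radius contain the
closed enlargements. -/
theorem mul_hausdorffContent_le_measure {X : Type*} [PseudoMetricSpace X] [Nonempty X]
    [TopologicalSpace.SeparableSpace X] [MeasurableSpace X] [OpensMeasurableSpace X]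
    (μ : Measure X) {lam R : ℝ} (hlam : 0 < lam) {A S : Set X} (r : X → ℝ) (a : ℝ≥0∞)
    (hr : ∀ w ∈ A, 0 < r w) (hR : ∀ w ∈ A, r w ≤ R)
    (hS : ∀ w ∈ A, Metric.closedBall w (r w) ⊆ S)
    (h : ∀ w ∈ A, a * ENNReal.ofReal (r w ^ lam) ≤ μ (Metric.closedBall w (r w))) :
    a * hausdorffContent lam A ≤ ENNReal.ofReal (6 ^ lam) * μ S := by
  obtain ⟨D, hDA, hdisj, hcov⟩ := Vitali.exists_disjoint_subfamily_covering_enlargement_closedBall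
    A id r R hR 5 (by norm_num)
  have hcount : D.Countable := hdisj.countable_of_nonempty_interior fun w hw ↦
    ⟨w, Metric.ball_subset_interior_closedBall (Metric.mem_ball_self (hr w (hDA hw)))⟩
  have := hcount.to_subtype
  have hcontent : hausdorffContent lam A ≤ ∑' w : D, ENNReal.ofReal ((6 * r w) ^ lam) := by
    refine hausdorffContent_le_tsum hlam (fun w : D ↦ (w : X)) _
      (fun w ↦ by have := hr w (hDA w.2); positivity) fun w hw ↦ ?_
    obtain ⟨b, hb, hwb⟩ := hcov w hw
    refine Set.mem_iUnion.2 ⟨⟨b, hb⟩, Metric.closedBall_subset_ball ?_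
      (hwb (Metric.mem_closedBall_self (hr w hw).le))⟩
    have := hr b (hDA hb)
    linarith
  calc a * hausdorffContent lam A
      ≤ a * ∑' w : D, ENNReal.ofReal ((6 * r w) ^ lam) := by gcongr
    _ = ENNReal.ofReal (6 ^ lam) * ∑' w : D, a * ENNReal.ofReal (r w ^ lam) := by
        rw [← ENNReal.tsum_mul_left, ← ENNReal.tsum_mul_left]
        refine tsum_congr fun w ↦ ?_
        rw [Real.mul_rpow (by norm_num) (hr w (hDA w.2)).le, ENNReal.ofReal_mul (by positivity)]
        ring
    _ ≤ ENNReal.ofReal (6 ^ lam) * ∑' w : D, μ (Metric.closedBall (w : X) (r w)) := by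
        gcongr with w
        exact h w (hDA w.2)
    _ ≤ ENNReal.ofReal (6 ^ lam) * μ S := by
        gcongr
        refine (tsum_meas_le_meas_iUnion_of_disjoint μ (fun _ ↦ Metric.isClosed_closedBall.measurableSet)
          fun (v w : D) hvw ↦ hdisj v.2 w.2 (Subtype.coe_ne_coe.2 hvw)).trans ?_
        exact measure_mono (Set.iUnion_subset fun w ↦ hS w (hDA w.2))

/-! ### Averages, and two integral and summation estimates -/

/-- Jensen's inequality for `z ↦ ‖z - a‖ ^ p`, in extended nonnegative form. -/
theorem enorm_setAverage_sub_rpow_le {α : Type*} [MeasurableSpace α] {μ : Measure α} {B : Set α}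
    (hB₀ : μ B ≠ 0) (hB : μ B ≠ ⊤) {p : ℝ} (hp : 1 ≤ p) {u : α → ℂ} (hu : IntegrableOn u B μ)
    (a : ℂ) (hup : IntegrableOn (fun x ↦ ‖u x - a‖ ^ p) B μ) :
    ‖(⨍ x in B, u x ∂μ) - a‖ₑ ^ p ≤ (μ B)⁻¹ * ∫⁻ x in B, ‖u x - a‖ₑ ^ p ∂μ := by
  have hp₀ : 0 ≤ p := by linarith
  have hconv : ConvexOn ℝ Set.univ fun z : ℂ ↦ ‖z - a‖ ^ p := by
    have h₁ : ConvexOn ℝ Set.univ fun z : ℂ ↦ ‖z - a‖ := by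
      have := (convexOn_univ_norm (E := ℂ)).translate_left (-a)
      simpa only [Set.preimage_univ, Function.comp_def, ← sub_eq_add_neg] using this
    refine ConvexOn.comp (g := fun t : ℝ ↦ t ^ p) ?_ h₁ ?_
    · refine (convexOn_rpow hp).subset ?_ ?_
      · rintro _ ⟨z, -, rfl⟩
        exact norm_nonneg _
      · rw [Set.image_univ]
        refine (isPreconnected_range (by fun_prop)).ordConnected.convex
    · rintro _ ⟨z, -, rfl⟩ _ _ hzw
      exact Real.rpow_le_rpow (norm_nonneg _) hzw hp₀
  have hcont : Continuous fun z : ℂ ↦ ‖z - a‖ ^ p :=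
    (by fun_prop : Continuous fun z : ℂ ↦ ‖z - a‖).rpow_const fun _ ↦ Or.inr hp₀
  have key := hconv.map_set_average_le hcont.continuousOn isClosed_univ hB₀ hB
    (by simp) hu hup
  rw [← ofReal_norm, ENNReal.ofReal_rpow_of_nonneg (norm_nonneg _) hp₀]
  refine (ENNReal.ofReal_le_ofReal key).trans_eq ?_
  rw [setAverage_eq, smul_eq_mul, ENNReal.ofReal_mul (by positivity),
    ofReal_integral_eq_lintegral_ofReal hup (ae_of_all _ fun x ↦ by positivity)]
  congr 1
  · rw [measureReal_def, ENNReal.ofReal_inv_of_pos (ENNReal.toReal_pos hB₀ hB),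
      ENNReal.ofReal_toReal hB]
  · refine lintegral_congr fun x ↦ ?_
    rw [← ofReal_norm, ENNReal.ofReal_rpow_of_nonneg (norm_nonneg _) hp₀]

theorem lintegral_add_norm_sub_rpow_neg {E : Type*} [NormedAddCommGroup E] [NormedSpace ℝ E]
    [MeasurableSpace E] [BorelSpace E] [FiniteDimensional ℝ E] (μ : Measure E)
    [μ.IsAddHaarMeasure] (q : ℝ) {D : ℝ} (hD : 0 < D) (y : E) :
    ∫⁻ x, ENNReal.ofReal ((D + ‖x - y‖) ^ (-q)) ∂μ =
      ENNReal.ofReal (D ^ ((Module.finrank ℝ E : ℝ) - q)) *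
        ∫⁻ x, ENNReal.ofReal ((1 + ‖x‖) ^ (-q)) ∂μ := by
  rw [lintegral_sub_right_eq_self (fun x ↦ ENNReal.ofReal ((D + ‖x‖) ^ (-q))) y]
  have hmeas : Measurable fun x : E ↦ ENNReal.ofReal ((D + ‖x‖) ^ (-q)) := by fun_prop
  have hscale : ∫⁻ x, ENNReal.ofReal ((D + ‖D • x‖) ^ (-q)) ∂μ =
      ENNReal.ofReal |(D ^ Module.finrank ℝ E)⁻¹| * ∫⁻ x, ENNReal.ofReal ((D + ‖x‖) ^ (-q)) ∂μ := by
    rw [← lintegral_map (f := fun x : E ↦ ENNReal.ofReal ((D + ‖x‖) ^ (-q))) hmeas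
      (measurable_const_smul D), Measure.map_addHaar_smul μ hD.ne', lintegral_smul_measure,
      smul_eq_mul]
  have hfactor : ∀ x : E, ENNReal.ofReal ((D + ‖D • x‖) ^ (-q)) =
      ENNReal.ofReal (D ^ (-q)) * ENNReal.ofReal ((1 + ‖x‖) ^ (-q)) := fun x ↦ by
    rw [← ENNReal.ofReal_mul (by positivity), ← Real.mul_rpow hD.le (by positivity), norm_smul,
      Real.norm_of_nonneg hD.le]
    ring_nf
  simp_rw [hfactor] at hscale
  rw [lintegral_const_mul _ (by fun_prop), abs_of_pos (by positivity)] at hscale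
  rw [sub_eq_add_neg, Real.rpow_add hD, Real.rpow_natCast, ENNReal.ofReal_mul (by positivity),
    mul_assoc, hscale, ← mul_assoc, ← ENNReal.ofReal_mul (by positivity),
    mul_inv_cancel₀ (by positivity), ENNReal.ofReal_one, one_mul]

/-- If the sequence `v` reaches zero, some increment `v k - v (k + 1)` is at least the `k`-th term of
a geometric series with sum `‖v 0‖`, since the increments add up to `v 0`. -/
theorem exists_geometric_le_norm_sub {V : Type*} [NormedAddCommGroup V] (v : ℕ → V)
    {θ : ℝ} (hθ : 0 < θ) {K : ℕ} (hK : v K = 0) :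
    ∃ k, (1 - θ) * θ ^ k * ‖v 0‖ ≤ ‖v k - v (k + 1)‖ := by
  by_contra! hlt
  have hv₀ : 0 < ‖v 0‖ := by
    by_contra! h
    have := hlt 0
    rw [le_antisymm h (norm_nonneg _), mul_zero] at this
    exact absurd this (norm_nonneg _).not_gt
  have hsum : v 0 = ∑ k ∈ Finset.range K, (v k - v (k + 1)) := by
    rw [Finset.sum_range_sub', hK, sub_zero]
  have hgeom : (1 - θ) * ∑ k ∈ Finset.range K, θ ^ k = 1 - θ ^ K := mul_neg_geom_sum θ K
  have : ‖v 0‖ ≤ (1 - θ ^ K) * ‖v 0‖ := by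
    calc ‖v 0‖ ≤ ∑ k ∈ Finset.range K, ‖v k - v (k + 1)‖ := by
          conv_lhs => rw [hsum]
          exact norm_sum_le _ _
      _ ≤ ∑ k ∈ Finset.range K, (1 - θ) * θ ^ k * ‖v 0‖ :=
          Finset.sum_le_sum fun k _ ↦ (hlt k).le
      _ = (1 - θ ^ K) * ‖v 0‖ := by rw [← hgeom, Finset.mul_sum, Finset.sum_mul]
  nlinarith [mul_pos (pow_pos hθ K) hv₀]

/-! ### Distance to the boundary and corkscrew points -/

theorem ball_infDist_frontier_subset {E : Type*} [NormedAddCommGroup E] [NormedSpace ℝ E]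
    {G : Set E} (hG : IsOpen G) {z : E} (hz : z ∈ G) :
    Metric.ball z (Metric.infDist z (frontier G)) ⊆ G := by
  rcases (Metric.infDist_nonneg (x := z) (s := frontier G)).eq_or_lt with h | h
  · simp [← h]
  refine (convex_ball z _).isPreconnected.subset_left_of_subset_union hG
    (isClosed_closure (s := G)).isOpen_compl
    (Set.disjoint_compl_right_iff_subset.2 subset_closure) (fun y hy ↦ ?_)
    ⟨z, Metric.mem_ball_self h, hz⟩
  by_contra hy'
  simp only [Set.mem_union, Set.mem_compl_iff, not_or, not_not] at hy'
  have hyf : y ∈ frontier G := by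
    rw [hG.frontier_eq]
    exact ⟨hy'.2, hy'.1⟩
  have := Metric.infDist_le_dist_of_mem (x := z) hyf
  rw [Metric.mem_ball'] at hy
  linarith

theorem infDist_frontier_pos {X : Type*} [PseudoMetricSpace X] {G : Set X} (hG : IsOpen G)
    (hfr : (frontier G).Nonempty) {x : X} (hx : x ∈ G) : 0 < Metric.infDist x (frontier G) := by
  rw [← isClosed_frontier.notMem_iff_infDist_pos hfr, hG.frontier_eq]
  exact fun h ↦ h.2 hx

/-- The interior corkscrew condition with constant `c`: within distance `r` of every boundary point
`w` there is a point of `G` whose distance to the boundary is at least `c * r`. The scales `r` are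
those not exceeding the distance of some point `x` of `G` to the boundary, so that no bound on the
diameter of `G` enters. -/
def HasInteriorCorkscrews {X : Type*} [PseudoMetricSpace X] (G : Set X) (c : ℝ) : Prop :=
  ∀ x ∈ G, ∀ w ∈ frontier G, ∀ r : ℝ, 0 < r → r ≤ Metric.infDist x (frontier G) →
    ∃ z ∈ G, dist z w ≤ r ∧ c * r ≤ Metric.infDist z (frontier G)

/-- The corkscrew point lies on the curve joining a point of `G` very close to `w` to `x`, at the
place where the curve has moved away from its starting point by `r / 4`; there the other endpoint is
even farther away. Only the distance condition on the curve is used, not its length. -/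
theorem IsUniformDomain.exists_hasInteriorCorkscrews {n : ℕ}
    {G : Set (EuclideanSpace ℝ (Fin n))} (hG : IsUniformDomain G) :
    ∃ c : ℝ, 0 < c ∧ c ≤ 1 / 4 ∧ HasInteriorCorkscrews G c := by
  obtain ⟨hopen, -, C, hC, hcurve⟩ := hG
  refine ⟨1 / C * (1 / 4), by positivity, ?_, fun x hx w hw r hr hrx ↦ ?_⟩
  · have : 1 / C ≤ 1 := (div_le_one (by linarith)).2 hC
    linarith
  obtain ⟨y, hy, hyw⟩ := Metric.mem_closure_iff.1 (frontier_subset_closure hw) (r / 4)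
    (by positivity)
  obtain ⟨l, γ, hl, hγ, -, hmaps, hγ₀, hγl, -, hcigar⟩ := hcurve y hy x hx
  have hxw := Metric.infDist_le_dist_of_mem (x := x) hw
  have hxy := dist_triangle_right x w y
  rw [dist_comm w y] at hyw
  have hyx : r / 4 ≤ dist x y := by
    have := dist_triangle x y w
    linarith
  obtain ⟨t, ht, htr⟩ : r / 4 ∈ (fun t ↦ dist (γ t) y) '' Set.Icc 0 l := by
    have hcont : ContinuousOn (fun t ↦ dist (γ t) y) (Set.Icc 0 l) :=
      (continuous_id.dist continuous_const).comp_continuousOn hγ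
    refine intermediate_value_Icc hl hcont ?_
    rw [hγ₀, hγl, dist_self]
    exact ⟨by positivity, hyx⟩
  simp only at htr
  have htri₁ := dist_triangle (γ t) y w
  have htri₂ := dist_triangle4 x (γ t) y w
  rw [dist_comm x (γ t)] at htri₂
  refine ⟨γ t, hmaps ht, by linarith, le_trans ?_ (hcigar t ht)⟩
  rw [mul_assoc]
  gcongr
  exact le_min (by linarith) (by linarith)

/-! ### The fractional energy density and averages over balls -/

/-- The density `y ↦ ∫_G |u(y) - u(z)|^p / |y - z|^σ dz` of the fractional energy of `u` in `G`; its
integral over `G` is the right-hand side of the Hardy inequality when `σ = n + s p`. The exponent `σ`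
is kept as a single parameter. -/
noncomputable def gagliardoDensity {X : Type*} [PseudoEMetricSpace X] [MeasureSpace X]
    (G : Set X) (p σ : ℝ) (u : X → ℂ) (y : X) : ℝ≥0∞ :=
  ∫⁻ z in G, ‖u y - u z‖ₑ ^ p / edist y z ^ σ

section Averages

variable {E : Type*} [NormedAddCommGroup E] [MeasureSpace E] [BorelSpace E]

theorem measurable_gagliardoDensity [SecondCountableTopology E] [SFinite (volume : Measure E)]
    {u : E → ℂ} (hu : Continuous u) (G : Set E) (p σ : ℝ) :
    Measurable (gagliardoDensity G p σ u) := by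
  refine Measurable.lintegral_prod_right' (f := fun q : E × E ↦
    ‖u q.1 - u q.2‖ₑ ^ p / edist q.1 q.2 ^ σ) ?_
  have := hu.measurable
  fun_prop

variable [NormedSpace ℝ E] [FiniteDimensional ℝ E] [(volume : Measure E).IsAddHaarMeasure]

theorem integrableOn_ball_of_continuous {F : Type*} [NormedAddCommGroup F] {f : E → F}
    (hf : Continuous f) (z : E) (ρ : ℝ) : IntegrableOn f (Metric.ball z ρ) volume :=
  have := FiniteDimensional.proper ℝ E
  (hf.continuousOn.integrableOn_compact (isCompact_closedBall z ρ)).mono_set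
    Metric.ball_subset_closedBall

theorem enorm_average_sub_rpow_le_lintegral {u : E → ℂ} (hu : Continuous u) {p : ℝ} (hp : 1 ≤ p)
    (z : E) {ρ : ℝ} (hρ : 0 < ρ) (a : ℂ) :
    ‖(⨍ y in Metric.ball z ρ, u y) - a‖ₑ ^ p ≤
      (volume (Metric.ball z ρ))⁻¹ * ∫⁻ y in Metric.ball z ρ, ‖u y - a‖ₑ ^ p := by
  have hup : Continuous fun y ↦ ‖u y - a‖ ^ p :=
    (by fun_prop : Continuous fun y ↦ ‖u y - a‖).rpow_const fun _ ↦ Or.inr (by linarith)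
  have := FiniteDimensional.proper ℝ E
  exact enorm_setAverage_sub_rpow_le (Metric.measure_ball_pos _ _ hρ).ne'
    measure_ball_lt_top.ne hp (integrableOn_ball_of_continuous hu z ρ) a
    (integrableOn_ball_of_continuous hup z ρ)

/-- The average of `u` over a ball in `G` differs from `u x` by no more than the energy density at `x`
allows, whatever the position of `x`: the energy is nonlocal, so no chain of balls joining `x` to the
ball is needed. -/
theorem enorm_average_sub_rpow_le {u : E → ℂ} (hu : Continuous u) {p σ : ℝ} (hp : 1 ≤ p)
    (hσ : 0 ≤ σ) {G : Set E} {x z : E} {ρ L : ℝ} (hρ : 0 < ρ) (hBG : Metric.ball z ρ ⊆ G)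
    (hL : ∀ y ∈ Metric.ball z ρ, dist x y ≤ L) :
    ‖(⨍ y in Metric.ball z ρ, u y) - u x‖ₑ ^ p ≤
      (volume (Metric.ball z ρ))⁻¹ * (ENNReal.ofReal (L ^ σ) * gagliardoDensity G p σ u x) := by
  refine (enorm_average_sub_rpow_le_lintegral hu hp z hρ (u x)).trans ?_
  gcongr
  have hL₀ : 0 ≤ L := dist_nonneg.trans (hL z (Metric.mem_ball_self hρ))
  calc ∫⁻ y in Metric.ball z ρ, ‖u y - u x‖ₑ ^ p
      ≤ ∫⁻ y in Metric.ball z ρ,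
          ENNReal.ofReal (L ^ σ) * (‖u x - u y‖ₑ ^ p / edist x y ^ σ) := by
        refine setLIntegral_mono' Metric.isOpen_ball.measurableSet fun y hy ↦ ?_
        rcases eq_or_ne y x with rfl | hyx
        · simp [ENNReal.zero_rpow_of_pos (zero_lt_one.trans_le hp)]
        have he₀ : edist x y ^ σ ≠ 0 :=
          (ENNReal.rpow_pos (edist_pos.2 hyx.symm) (edist_ne_top _ _)).ne'
        have he : edist x y ^ σ ≠ ⊤ := ENNReal.rpow_ne_top_of_nonneg hσ (edist_ne_top _ _)
        rw [enorm_sub_rev]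
        calc ‖u x - u y‖ₑ ^ p = edist x y ^ σ * (‖u x - u y‖ₑ ^ p / edist x y ^ σ) :=
              (ENNReal.mul_div_cancel he₀ he).symm
          _ ≤ _ := by
              gcongr
              rw [← ENNReal.ofReal_rpow_of_nonneg hL₀ hσ, edist_dist]
              gcongr
              exact hL y hy
    _ = ENNReal.ofReal (L ^ σ) *
          ∫⁻ y in Metric.ball z ρ, ‖u x - u y‖ₑ ^ p / edist x y ^ σ :=
        lintegral_const_mul' _ _ ENNReal.ofReal_ne_top
    _ ≤ _ := by
        gcongr
        exact lintegral_mono_set hBG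

/-- Comparison of the averages of `u` over two balls, with the energy density integrated only over the
first ball. -/
theorem enorm_average_sub_average_rpow_le {u : E → ℂ} (hu : Continuous u) {p σ : ℝ} (hp : 1 ≤ p)
    (hσ : 0 ≤ σ) {G : Set E} {z z' : E} {ρ ρ' L : ℝ} (hρ : 0 < ρ) (hρ' : 0 < ρ')
    (hBG : Metric.ball z' ρ' ⊆ G)
    (hL : ∀ x ∈ Metric.ball z ρ, ∀ y ∈ Metric.ball z' ρ', dist x y ≤ L) :
    ‖(⨍ y in Metric.ball z ρ, u y) - ⨍ y in Metric.ball z' ρ', u y‖ₑ ^ p ≤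
      (volume (Metric.ball z ρ))⁻¹ * ((volume (Metric.ball z' ρ'))⁻¹ * (ENNReal.ofReal (L ^ σ) *
        ∫⁻ y in Metric.ball z ρ, gagliardoDensity G p σ u y)) := by
  have := FiniteDimensional.proper ℝ E
  refine (enorm_average_sub_rpow_le_lintegral hu hp z hρ _).trans ?_
  gcongr
  rw [← lintegral_const_mul' _ _ ENNReal.ofReal_ne_top, ← lintegral_const_mul' _ _
    (ENNReal.inv_ne_top.2 (Metric.measure_ball_pos _ _ hρ').ne')]
  refine setLIntegral_mono' Metric.isOpen_ball.measurableSet fun x hx ↦ ?_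
  rw [enorm_sub_rev]
  exact enorm_average_sub_rpow_le hu hp hσ hρ' hBG (hL x hx)

theorem inv_volume_ball (z : E) {ρ : ℝ} (hρ : 0 < ρ) :
    (volume (Metric.ball z ρ))⁻¹ = ENNReal.ofReal (ρ ^ (-(Module.finrank ℝ E : ℝ))) *
      (volume (Metric.ball (0 : E) 1))⁻¹ := by
  have := FiniteDimensional.proper ℝ E
  rw [Measure.addHaar_ball_of_pos _ _ hρ, ENNReal.mul_inv (Or.inl (by positivity))
    (Or.inl ENNReal.ofReal_ne_top), ← ENNReal.ofReal_inv_of_pos (by positivity),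
    Real.rpow_neg hρ.le, Real.rpow_natCast]

end Averages

section Boundary

variable {E : Type*} [NormedAddCommGroup E] [MeasureSpace E]

/-! ### Estimates at the boundary -/

/-- The measure on `G` with density `dist (y, ∂G) ^ ε` times the energy density of `u`. -/
noncomputable def weightedEnergy (G : Set E) (p σ ε : ℝ) (u : E → ℂ) : Measure E :=
  (volume.restrict G).withDensity fun y ↦
    ENNReal.ofReal (Metric.infDist y (frontier G) ^ ε) * gagliardoDensity G p σ u y

/-- On a set that stays at distance at least `a` from the boundary, the weight
`dist (y, ∂G) ^ ε` can be inserted at the cost of the factor `a ^ (-ε)`. -/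
theorem setLIntegral_gagliardoDensity_le_weightedEnergy {G B S : Set E} (p σ : ℝ) {ε : ℝ}
    (hε : 0 ≤ ε) (u : E → ℂ) {a : ℝ} (ha : 0 < a) (hB : MeasurableSet B) (hBG : B ⊆ G)
    (hBS : B ⊆ S) (hBa : ∀ y ∈ B, a ≤ Metric.infDist y (frontier G)) :
    ∫⁻ y in B, gagliardoDensity G p σ u y ≤
      ENNReal.ofReal (a ^ (-ε)) * weightedEnergy G p σ ε u S := by
  refine le_trans ?_ (mul_le_mul_right (measure_mono hBS) _)
  rw [weightedEnergy, withDensity_apply _ hB, Measure.restrict_restrict hB,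
    Set.inter_eq_self_of_subset_left hBG, ← lintegral_const_mul' _ _ ENNReal.ofReal_ne_top]
  refine setLIntegral_mono' hB fun y hy ↦ ?_
  rw [← mul_assoc, ← ENNReal.ofReal_mul (by positivity)]
  refine le_mul_of_one_le_left' ?_
  rw [ENNReal.one_le_ofReal, Real.rpow_neg ha.le, ← div_eq_inv_mul, one_le_div (by positivity)]
  exact Real.rpow_le_rpow ha.le (hBa y hy) hε

variable [BorelSpace E] [NormedSpace ℝ E] [FiniteDimensional ℝ E] [(volume : Measure E).IsAddHaarMeasure]

/-- If `u` vanishes near a boundary point `w` close to `x`, then the average of `u` over a ball centred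
at `x` is controlled by the weighted energy of some ball centred at `w`. The averages of `u` over
corkscrew balls at the scales `2 ^ (-k) * dist (x, ∂G)` near `w` run from the average at `x` to zero,
so some increment is large. With `σ = n + s p` the exponent `lam` is `n - s p + 2 ε`: one `ε` pays for
the geometric series, the other for the weight. -/
theorem HasInteriorCorkscrews.exists_radius_average_le {G : Set E} (hG : IsOpen G) {c : ℝ}
    (hc₀ : 0 < c) (hc₁ : c ≤ 1 / 4) (hcork : HasInteriorCorkscrews G c) {p σ ε lam : ℝ}
    (hp : 1 ≤ p) (hσ : 0 ≤ σ) (hε : 0 < ε)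
    (hlam : lam = 2 * Module.finrank ℝ E - σ + 2 * ε) :
    ∃ K : ℝ≥0∞, K ≠ ⊤ ∧ ∀ u : E → ℂ, Continuous u → ∀ x ∈ G, ∀ w ∈ frontier G,
      dist w x < 2 * Metric.infDist x (frontier G) → (∀ᶠ y in nhds w, u y = 0) →
      ∃ r : ℝ, 0 < r ∧ r ≤ 3 * Metric.infDist x (frontier G) ∧
        ‖⨍ y in Metric.ball x (c / 2 * Metric.infDist x (frontier G)), u y‖ₑ ^ p *
          ENNReal.ofReal (Metric.infDist x (frontier G) ^ (-ε)) * ENNReal.ofReal (r ^ lam) ≤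
            K * weightedEnergy G p σ ε u (Metric.closedBall w r) := by
  have := FiniteDimensional.proper ℝ E
  set N : ℝ := ((Module.finrank ℝ E : ℕ) : ℝ)
  have hp₀ : 0 < p := by linarith
  -- With this ratio `(θ ^ k) ^ p = (ρ k / d) ^ ε` for the scales `ρ k = d * 2 ^ (-k)` below.
  set θ : ℝ := (1 / 2) ^ (ε / p) with hθ
  have hθ₀ : 0 < θ := by positivity
  have hθ₁ : θ < 1 := Real.rpow_lt_one (by norm_num) (by norm_num) (by positivity)
  set W : ℝ≥0∞ := (volume (Metric.ball (0 : E) 1))⁻¹ with hW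
  have hW_top : W ≠ ⊤ := ENNReal.inv_ne_top.2 (Metric.measure_ball_pos _ _ one_pos).ne'
  set κ : ℝ := (c / 2) ^ (-N) * (c / 4) ^ (-N) * 5 ^ σ * (c / 2) ^ (-ε) with hκ
  refine ⟨ENNReal.ofReal (3 ^ lam * ((1 - θ) ^ p)⁻¹ * κ) * W * W,
    ENNReal.mul_ne_top (ENNReal.mul_ne_top ENNReal.ofReal_ne_top hW_top) hW_top,
    fun u hu x hx w hw hwx hvanish ↦ ?_⟩
  set d := Metric.infDist x (frontier G) with hd_def
  have hd : 0 < d := infDist_frontier_pos hG ⟨w, hw⟩ hx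
  set ρ : ℕ → ℝ := fun k ↦ d * (1 / 2) ^ k with hρ_def
  have hρ : ∀ k, 0 < ρ k := fun k ↦ by positivity
  have hρd : ∀ k, ρ k ≤ d := fun k ↦
    mul_le_of_le_one_right hd.le (pow_le_one₀ (by norm_num) (by norm_num))
  -- The point `x` itself serves as the corkscrew point at the largest scale; its distance to `w` is
  -- only bounded by `2 * d`, whence the factor `2`.
  have hcenter : ∀ k, ∃ z ∈ G, dist z w ≤ 2 * ρ k ∧ c * ρ k ≤ Metric.infDist z (frontier G) ∧
      (k = 0 → z = x) := by
    intro k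
    rcases k.eq_zero_or_pos with rfl | hk
    · refine ⟨x, hx, ?_, ?_, fun _ ↦ rfl⟩
      · simp only [hρ_def, pow_zero, mul_one]
        rw [dist_comm]
        exact hwx.le
      · simp only [hρ_def, pow_zero, mul_one]
        nlinarith
    · obtain ⟨z, hz, hzw, hzd⟩ := hcork x hx w hw (ρ k) (hρ k) (hρd k)
      exact ⟨z, hz, by linarith [hρ k], hzd, fun h ↦ absurd h hk.ne'⟩
  choose z hzG hzw hzd hz₀ using hcenter
  have hz₀ := hz₀ 0 rfl
  have hsmall : ∀ k, c / 2 * ρ k ≤ ρ k := fun k ↦ by nlinarith [hρ k]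
  have hball_w : ∀ k, ∀ y ∈ Metric.ball (z k) (c / 2 * ρ k), dist y w ≤ 3 * ρ k := by
    intro k y hy
    have h₁ := Metric.mem_ball.1 hy
    have h₂ := dist_triangle y (z k) w
    linarith [hzw k, hsmall k]
  have hball_G : ∀ k, Metric.ball (z k) (c / 2 * ρ k) ⊆ G := fun k ↦
    (Metric.ball_subset_ball (by nlinarith [hρ k, hzd k])).trans
      (ball_infDist_frontier_subset hG (hzG k))
  have hball_d : ∀ k, ∀ y ∈ Metric.ball (z k) (c / 2 * ρ k),
      c / 2 * ρ k ≤ Metric.infDist y (frontier G) := by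
    intro k y hy
    have h₁ := Metric.mem_ball'.1 hy
    have h₂ := Metric.infDist_le_infDist_add_dist (s := frontier G) (x := z k) (y := y)
    linarith [hzd k]
  set v : ℕ → ℂ := fun k ↦ ⨍ y in Metric.ball (z k) (c / 2 * ρ k), u y with hv
  obtain ⟨K, hK⟩ : ∃ K, v K = 0 := by
    obtain ⟨η, hη, hηu⟩ := Metric.eventually_nhds_iff.1 hvanish
    obtain ⟨K, hK⟩ := exists_pow_lt_of_lt_one (show 0 < η / (3 * d) by positivity)
      (show (1 / 2 : ℝ) < 1 by norm_num)
    have hKη : 3 * ρ K < η := by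
      rw [lt_div_iff₀ (by positivity)] at hK
      simp only [hρ_def]
      linarith
    refine ⟨K, ?_⟩
    simp only [hv, setAverage_eq]
    rw [setIntegral_eq_zero_of_forall_eq_zero, smul_zero]
    exact fun y hy ↦ hηu ((hball_w K y hy).trans_lt hKη)
  obtain ⟨k, hk⟩ := exists_geometric_le_norm_sub v hθ₀ hK
  refine ⟨3 * ρ k, by linarith [hρ k], by linarith [hρd k], ?_⟩
  have hρk := hρ k
  have hρ_succ : c / 2 * ρ (k + 1) = c / 4 * ρ k := by
    simp only [hρ_def, pow_succ]
    ring
  have hupper : ‖v k - v (k + 1)‖ₑ ^ p ≤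
      ENNReal.ofReal ((c / 2 * ρ k) ^ (-N) * (c / 4 * ρ k) ^ (-N) * (5 * ρ k) ^ σ *
        (c / 2 * ρ k) ^ (-ε)) * W * W *
          weightedEnergy G p σ ε u (Metric.closedBall w (3 * ρ k)) := by
    refine (enorm_average_sub_average_rpow_le (G := G) (L := 5 * ρ k) hu hp hσ
      (by positivity) (mul_pos (by positivity) (hρ (k + 1))) (hball_G _) fun y hy y' hy' ↦ ?_).trans ?_
    · have h₁ := hball_w k y hy
      have h₂ := hball_w (k + 1) y' hy'
      have h₃ := dist_triangle_right y y' w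
      have h₄ : ρ (k + 1) = ρ k / 2 := by
        simp only [hρ_def, pow_succ]
        ring
      linarith
    · rw [inv_volume_ball _ (by positivity), inv_volume_ball _ (mul_pos (by positivity) (hρ _)),
        hρ_succ, ENNReal.ofReal_mul (by positivity), ENNReal.ofReal_mul (by positivity),
        ENNReal.ofReal_mul (by positivity)]
      have henergy := setLIntegral_gagliardoDensity_le_weightedEnergy p σ hε.le u
        (S := Metric.closedBall w (3 * ρ k)) (show 0 < c / 2 * ρ k by positivity)
        Metric.isOpen_ball.measurableSet (hball_G k) (fun y hy ↦ hball_w k y hy) (hball_d k)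
      refine (mul_le_mul_right (mul_le_mul_right (mul_le_mul_right henergy _) _) _).trans_eq ?_
      ring
  have hlower : ENNReal.ofReal ((1 - θ) ^ p * (ρ k / d) ^ ε) * ‖v 0‖ₑ ^ p ≤
      ‖v k - v (k + 1)‖ₑ ^ p := by
    have hθk : (1 - θ) ^ p * (ρ k / d) ^ ε = ((1 - θ) * θ ^ k) ^ p := by
      rw [Real.mul_rpow (by linarith) (by positivity)]
      congr 1
      have : ρ k / d = (1 / 2) ^ k := by
        simp only [hρ_def]
        field_simp
      rw [this, hθ, ← Real.rpow_natCast, ← Real.rpow_natCast, ← Real.rpow_mul (by positivity),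
        ← Real.rpow_mul (by positivity), ← Real.rpow_mul (by positivity)]
      congr 1
      field_simp
    have h1θ : 0 ≤ (1 - θ) * θ ^ k := mul_nonneg (by linarith) (by positivity)
    rw [hθk, ← ENNReal.ofReal_rpow_of_nonneg h1θ hp₀.le,
      ← ENNReal.mul_rpow_of_nonneg _ _ hp₀.le]
    refine ENNReal.rpow_le_rpow ?_ hp₀.le
    rw [← ofReal_norm, ← ofReal_norm, ← ENNReal.ofReal_mul h1θ]
    exact ENNReal.ofReal_le_ofReal hk
  have hv₀ : v 0 = ⨍ y in Metric.ball x (c / 2 * d), u y := by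
    simp only [hv, hz₀, hρ_def, pow_zero, mul_one]
  have h1θ : 0 < (1 - θ) ^ p := Real.rpow_pos_of_pos (by linarith) _
  have hreal₁ : d ^ (-ε) * (3 * ρ k) ^ lam = 3 ^ lam * ((1 - θ) ^ p)⁻¹ * ρ k ^ (lam - ε) *
      ((1 - θ) ^ p * (ρ k / d) ^ ε) := by
    rw [Real.mul_rpow (by norm_num) hρk.le, Real.div_rpow hρk.le hd.le, Real.rpow_neg hd.le,
      Real.rpow_sub hρk]
    have := Real.rpow_pos_of_pos hρk ε
    have := Real.rpow_pos_of_pos hd ε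
    field_simp
  have hreal₂ : ρ k ^ (lam - ε) * ((c / 2 * ρ k) ^ (-N) * (c / 4 * ρ k) ^ (-N) * (5 * ρ k) ^ σ *
        (c / 2 * ρ k) ^ (-ε)) = κ := by
    have hexp : ρ k ^ (lam - ε) * ρ k ^ (-N) * ρ k ^ (-N) * ρ k ^ σ * ρ k ^ (-ε) = 1 := by
      rw [← Real.rpow_add hρk, ← Real.rpow_add hρk, ← Real.rpow_add hρk, ← Real.rpow_add hρk,
        hlam]
      ring_nf
      exact Real.rpow_zero _
    rw [Real.mul_rpow (by positivity) hρk.le, Real.mul_rpow (by positivity) hρk.le,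
      Real.mul_rpow (by positivity) hρk.le, Real.mul_rpow (by positivity) hρk.le, hκ]
    linear_combination ((c / 2) ^ (-N) * (c / 4) ^ (-N) * 5 ^ σ * (c / 2) ^ (-ε)) * hexp
  calc ‖⨍ y in Metric.ball x (c / 2 * d), u y‖ₑ ^ p * ENNReal.ofReal (d ^ (-ε)) *
        ENNReal.ofReal ((3 * ρ k) ^ lam)
      = ENNReal.ofReal (3 ^ lam * ((1 - θ) ^ p)⁻¹ * ρ k ^ (lam - ε)) *
          (ENNReal.ofReal ((1 - θ) ^ p * (ρ k / d) ^ ε) * ‖v 0‖ₑ ^ p) := by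
        rw [← hv₀, mul_assoc, ← ENNReal.ofReal_mul (by positivity), hreal₁,
          ENNReal.ofReal_mul (by positivity)]
        ring
    _ ≤ ENNReal.ofReal (3 ^ lam * ((1 - θ) ^ p)⁻¹ * ρ k ^ (lam - ε)) *
          (ENNReal.ofReal ((c / 2 * ρ k) ^ (-N) * (c / 4 * ρ k) ^ (-N) * (5 * ρ k) ^ σ *
            (c / 2 * ρ k) ^ (-ε)) * W * W *
              weightedEnergy G p σ ε u (Metric.closedBall w (3 * ρ k))) :=
        mul_le_mul_right (hlower.trans hupper) _
    _ = _ := by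
        rw [← hreal₂, ← mul_assoc (3 ^ lam * ((1 - θ) ^ p)⁻¹), ENNReal.ofReal_mul
          (p := 3 ^ lam * ((1 - θ) ^ p)⁻¹ * ρ k ^ (lam - ε)) (by positivity)]
        ring

/-- Under the inner boundary density condition, the average of `u` over a ball centred at `x` is
controlled by the weighted energy near `x`: the radii found at the individual boundary points feed
the covering estimate for the Hausdorff content. -/
theorem HasInteriorCorkscrews.exists_average_le_weightedEnergy {G : Set E} (hG : IsOpen G) {c : ℝ}
    (hc₀ : 0 < c) (hc₁ : c ≤ 1 / 4) (hcork : HasInteriorCorkscrews G c) {p σ ε lam : ℝ}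
    (hp : 1 ≤ p) (hσ : 0 ≤ σ) (hε : 0 < ε) (hlam₀ : 0 < lam)
    (hlam : lam = 2 * Module.finrank ℝ E - σ + 2 * ε) (hfr : (frontier G).Nonempty)
    {C : ℝ} (hC : 0 < C) (hdens : ∀ x ∈ G,
      ENNReal.ofReal (C * Metric.infDist x (frontier G) ^ lam) ≤ hausdorffContent lam
        (Metric.ball x (2 * Metric.infDist x (frontier G)) ∩ frontier G)) :
    ∃ K : ℝ≥0∞, K ≠ ⊤ ∧ ∀ u : E → ℂ, Continuous u → tsupport u ⊆ G → ∀ x ∈ G,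
      ‖⨍ y in Metric.ball x (c / 2 * Metric.infDist x (frontier G)), u y‖ₑ ^ p *
        ENNReal.ofReal (Metric.infDist x (frontier G) ^ (lam - ε)) ≤
          K * weightedEnergy G p σ ε u
            (Metric.ball x (6 * Metric.infDist x (frontier G))) := by
  have := FiniteDimensional.proper ℝ E
  obtain ⟨K, hK, hest⟩ := hcork.exists_radius_average_le hG hc₀ hc₁ hp hσ hε hlam
  refine ⟨ENNReal.ofReal (C⁻¹ * 6 ^ lam) * K, ENNReal.mul_ne_top ENNReal.ofReal_ne_top hK,
    fun u hu hsupp x hx ↦ ?_⟩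
  have hest := hest u hu x hx
  set d := Metric.infDist x (frontier G) with hd_def
  have hd : 0 < d := infDist_frontier_pos hG hfr hx
  set A := Metric.ball x (2 * d) ∩ frontier G with hA
  have hrad : ∀ w ∈ A, ∃ r : ℝ, 0 < r ∧ r ≤ 3 * d ∧
      ‖⨍ y in Metric.ball x (c / 2 * d), u y‖ₑ ^ p * ENNReal.ofReal (d ^ (-ε)) *
        ENNReal.ofReal (r ^ lam) ≤ K * weightedEnergy G p σ ε u (Metric.closedBall w r) := by
    rintro w ⟨hwx, hw⟩
    refine hest w hw hwx (notMem_tsupport_iff_eventuallyEq.1 fun h ↦ ?_)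
    rw [hG.frontier_eq] at hw
    exact hw.2 (hsupp h)
  choose! r hr₀ hr hrest using hrad
  have hcover := mul_hausdorffContent_le_measure (K • weightedEnergy G p σ ε u) hlam₀
    (S := Metric.ball x (6 * d)) r _ hr₀ hr (fun w hw y hy ↦ ?_) hrest
  · have hdx := (mul_le_mul_right (hdens x hx) _).trans hcover
    rw [Measure.smul_apply, smul_eq_mul] at hdx
    have hsplit : d ^ (lam - ε) = C⁻¹ * (d ^ (-ε) * (C * d ^ lam)) := by
      rw [sub_eq_neg_add, Real.rpow_add hd]
      field_simp
    rw [hsplit, ENNReal.ofReal_mul (p := C⁻¹) (by positivity),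
      ENNReal.ofReal_mul (p := d ^ (-ε)) (by positivity), mul_left_comm,
      ENNReal.ofReal_mul (p := C⁻¹) (by positivity), mul_assoc (ENNReal.ofReal C⁻¹), mul_assoc]
    refine mul_le_mul_right ?_ _
    rwa [← mul_assoc, mul_assoc (ENNReal.ofReal _)]
  · have h₁ := Metric.mem_ball.1 hw.1
    have h₂ := Metric.mem_closedBall.1 hy
    have h₃ := dist_triangle y w x
    have h₄ := hr w hw
    rw [Metric.mem_ball]
    linarith

/-- Summation over all `x`: by Tonelli's theorem the bound reduces to
`∫ dist (x, ∂G) ^ (-n - ε) dx ≤ K * dist (y, ∂G) ^ (-ε)`, the integral being over those `x` whose ball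
contains `y`. For `ε = 0` this integral diverges logarithmically, which is why the energy carries a
weight. -/
theorem exists_lintegral_weightedEnergy_le {G : Set E} (hG : IsOpen G)
    (hfr : (frontier G).Nonempty) (p σ : ℝ) {ε : ℝ} (hε : 0 < ε) :
    ∃ K : ℝ≥0∞, K ≠ ⊤ ∧ ∀ u : E → ℂ, Continuous u →
      ∫⁻ x in G, ENNReal.ofReal (Metric.infDist x (frontier G) ^ (-(Module.finrank ℝ E + ε))) *
        weightedEnergy G p σ ε u (Metric.ball x (6 * Metric.infDist x (frontier G))) ≤
          K * ∫⁻ y in G, gagliardoDensity G p σ u y := by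
  have := FiniteDimensional.proper ℝ E
  set q : ℝ := Module.finrank ℝ E + ε with hq
  have hI : ∫⁻ x : E, ENNReal.ofReal ((1 + ‖x‖) ^ (-q)) < ⊤ :=
    finite_integral_one_add_norm (by linarith)
  have hq₀ : 0 < q := by positivity
  refine ⟨ENNReal.ofReal (13 ^ q) * ∫⁻ x : E, ENNReal.ofReal ((1 + ‖x‖) ^ (-q)),
    ENNReal.mul_ne_top ENNReal.ofReal_ne_top hI.ne, fun u hu ↦ ?_⟩
  set δ : E → ℝ := fun x ↦ Metric.infDist x (frontier G) with hδ
  have hδ_cont : Continuous δ := Metric.continuous_infDist_pt _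
  have hδ_meas := hδ_cont.measurable
  set g := gagliardoDensity G p σ u with hg
  have hg_meas : Measurable g := measurable_gagliardoDensity hu G p σ
  set S : Set (E × E) := {q | dist q.2 q.1 < 6 * δ q.1} with hS
  have hS_meas : MeasurableSet S :=
    (isOpen_lt (by fun_prop) (by fun_prop)).measurableSet
  set f : E → E → ℝ≥0∞ := fun x y ↦ S.indicator (fun _ ↦
    ENNReal.ofReal (δ x ^ (-q)) * (ENNReal.ofReal (δ y ^ ε) * g y)) (x, y) with hf
  have hf_meas : Measurable (Function.uncurry f) := by
    have : Function.uncurry f = S.indicator fun z : E × E ↦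
        ENNReal.ofReal (δ z.1 ^ (-q)) * (ENNReal.ofReal (δ z.2 ^ ε) * g z.2) := by
      ext ⟨x, y⟩
      simp only [hf, Function.uncurry, Set.indicator]
    rw [this]
    refine Measurable.indicator ?_ hS_meas
    fun_prop
  calc ∫⁻ x in G, ENNReal.ofReal (δ x ^ (-q)) *
        weightedEnergy G p σ ε u (Metric.ball x (6 * δ x))
      = ∫⁻ x in G, ∫⁻ y in G, f x y := by
        refine lintegral_congr fun x ↦ ?_
        rw [weightedEnergy, withDensity_apply _ Metric.isOpen_ball.measurableSet,
          ← lintegral_indicator Metric.isOpen_ball.measurableSet,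
          ← lintegral_const_mul' _ _ ENNReal.ofReal_ne_top]
        refine lintegral_congr fun y ↦ ?_
        by_cases h : dist y x < 6 * δ x
        · have hfxy : f x y = ENNReal.ofReal (δ x ^ (-q)) * (ENNReal.ofReal (δ y ^ ε) * g y) :=
            Set.indicator_of_mem (s := S) (a := (x, y)) h _
          rw [Set.indicator_of_mem (Metric.mem_ball.2 h), hfxy]
        · have hfxy : f x y = 0 := Set.indicator_of_notMem (s := S) (a := (x, y)) h _
          rw [Set.indicator_of_notMem (mt Metric.mem_ball.1 h), mul_zero, hfxy]
    _ = ∫⁻ y in G, ∫⁻ x in G, f x y := lintegral_lintegral_swap hf_meas.aemeasurable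
    _ ≤ ∫⁻ y in G, (ENNReal.ofReal (13 ^ q) *
          ∫⁻ x : E, ENNReal.ofReal ((1 + ‖x‖) ^ (-q))) * g y := by
        refine setLIntegral_mono' hG.measurableSet fun y hy ↦ ?_
        have hδy : 0 < δ y := infDist_frontier_pos hG hfr hy
        calc ∫⁻ x in G, f x y
            ≤ ∫⁻ x in G, (ENNReal.ofReal (13 ^ q) * (ENNReal.ofReal (δ y ^ ε) * g y)) *
                ENNReal.ofReal ((δ y + ‖x - y‖) ^ (-q)) := by
              refine setLIntegral_mono' hG.measurableSet fun x hx ↦ ?_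
              have hδx : 0 < δ x := infDist_frontier_pos hG hfr hx
              by_cases h : dist y x < 6 * δ x
              · have hfxy : f x y = ENNReal.ofReal (δ x ^ (-q)) *
                    (ENNReal.ofReal (δ y ^ ε) * g y) :=
                  Set.indicator_of_mem (s := S) (a := (x, y)) h _
                rw [hfxy, mul_right_comm, ← ENNReal.ofReal_mul (by positivity)]
                gcongr
                -- `δ y ≤ 7 * δ x` and `‖x - y‖ ≤ 6 * δ x` make the kernel comparable to a translate of
                -- the integrable one.
                have h₁ : δ y ≤ δ x + dist y x := Metric.infDist_le_infDist_add_dist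
                have h₂ : δ y + ‖x - y‖ ≤ 13 * δ x := by
                  rw [← dist_eq_norm, dist_comm]
                  linarith
                calc δ x ^ (-q) = 13 ^ q * (13 * δ x) ^ (-q) := by
                      rw [Real.mul_rpow (by norm_num) hδx.le, ← mul_assoc,
                        ← Real.rpow_add (by norm_num), add_neg_cancel, Real.rpow_zero, one_mul]
                  _ ≤ _ := by
                      gcongr ?_ * ?_
                      exact Real.rpow_le_rpow_of_nonpos (by positivity) h₂ (by linarith)
              · have hfxy : f x y = 0 := Set.indicator_of_notMem (s := S) (a := (x, y)) h _
                rw [hfxy]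
                exact zero_le
          _ ≤ ∫⁻ x, (ENNReal.ofReal (13 ^ q) * (ENNReal.ofReal (δ y ^ ε) * g y)) *
                ENNReal.ofReal ((δ y + ‖x - y‖) ^ (-q)) := setLIntegral_le_lintegral _ _
          _ = ENNReal.ofReal (δ y ^ ε * δ y ^ ((Module.finrank ℝ E : ℝ) - q)) *
                ((ENNReal.ofReal (13 ^ q) *
                  ∫⁻ x : E, ENNReal.ofReal ((1 + ‖x‖) ^ (-q))) * g y) := by
              rw [lintegral_const_mul _ (by fun_prop), lintegral_add_norm_sub_rpow_neg _ q hδy,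
                ENNReal.ofReal_mul (by positivity)]
              ring
          _ = _ := by
              rw [← Real.rpow_add hδy, hq]
              simp
    _ = _ := lintegral_const_mul _ hg_meas

end Boundary

/-! ### The fractional Hardy inequality -/

theorem corollary4p5 (n : ℕ) (s p : ℝ) (hs0 : 0 < s) (hs1 : s < 1) (hp : 1 < p)
    (hsp : s * p < n) (G : Set (EuclideanSpace ℝ (Fin n))) (hG : IsUniformDomain G)
    (hproper : G ≠ Set.univ)
    (hdens : ∃ lam : ℝ, (n : ℝ) - s * p < lam ∧ lam ≤ n ∧ InnerBoundaryDensity G lam) :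
    AdmitsFractionalHardy s p G := by
  obtain ⟨lam, hlam, -, C, hC, hcontent⟩ := hdens
  have hopen : IsOpen G := hG.1
  have hfr : (frontier G).Nonempty := nonempty_frontier_iff.2 ⟨hG.2.1.nonempty, hproper⟩
  obtain ⟨c, hc₀, hc₁, hcork⟩ := hG.exists_hasInteriorCorkscrews
  have hdim : Module.finrank ℝ (EuclideanSpace ℝ (Fin n)) = n := finrank_euclideanSpace_fin
  have hsp₀ : 0 < s * p := by positivity
  have hp₀ : 0 ≤ p := by linarith
  set σ : ℝ := n + s * p with hσ_def
  have hσ : 0 ≤ σ := by positivity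
  -- The gap between `lam` and `n - s * p` is shared equally between the two uses of `ε`.
  set ε : ℝ := (lam - (n - s * p)) / 2 with hε_def
  have hε : 0 < ε := by
    rw [hε_def]
    linarith
  obtain ⟨K₁, hK₁, havg⟩ := hcork.exists_average_le_weightedEnergy hopen hc₀ hc₁ hp.le hσ hε
    (by linarith) (by rw [hdim, hε_def, hσ_def]; ring) hfr hC hcontent
  obtain ⟨K₂, hK₂, hint⟩ := exists_lintegral_weightedEnergy_le hopen hfr p σ hε
  rw [hdim] at hint
  set W : ℝ≥0∞ := (volume (Metric.ball (0 : EuclideanSpace ℝ (Fin n)) 1))⁻¹ with hW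
  have hW_top : W ≠ ⊤ := ENNReal.inv_ne_top.2 (Metric.measure_ball_pos _ _ one_pos).ne'
  set K₃ : ℝ≥0∞ := ENNReal.ofReal ((c / 2) ^ (-(n : ℝ))) * W with hK₃
  set K : ℝ≥0∞ := 2 ^ (p - 1) * (K₃ + K₁ * K₂) with hK
  have hK_top : K ≠ ⊤ := by
    refine ENNReal.mul_ne_top (ENNReal.rpow_ne_top_of_nonneg (by linarith) (by simp)) ?_
    exact ENNReal.add_ne_top.2 ⟨ENNReal.mul_ne_top ENNReal.ofReal_ne_top hW_top,
      ENNReal.mul_ne_top hK₁ hK₂⟩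
  refine ⟨K.toReal + 1, by positivity, fun u hu _ hsupp ↦ ?_⟩
  have hu := hu.continuous
  set δ : EuclideanSpace ℝ (Fin n) → ℝ := fun x ↦ Metric.infDist x (frontier G) with hδ_def
  have hδ : ∀ x ∈ G, 0 < δ x := fun x hx ↦ infDist_frontier_pos hopen hfr hx
  set g := gagliardoDensity G p σ u with hg
  have hg_meas : Measurable g := measurable_gagliardoDensity hu G p σ
  -- Split `u x` into its deviation from the average over a ball centred at `x` and that average.
  have hpoint : ∀ x ∈ G, ‖u x‖ₑ ^ p / ENNReal.ofReal (δ x) ^ (s * p) ≤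
      2 ^ (p - 1) * (K₃ * g x + K₁ * (ENNReal.ofReal (δ x ^ (-(n + ε))) *
        weightedEnergy G p σ ε u (Metric.ball x (6 * δ x)))) := by
    intro x hx
    have hδx := hδ x hx
    set m := ⨍ y in Metric.ball x (c / 2 * δ x), u y with hm
    have hnear : ‖m - u x‖ₑ ^ p * ENNReal.ofReal (δ x ^ (-(s * p))) ≤ K₃ * g x := by
      have hball : Metric.ball x (c / 2 * δ x) ⊆ Metric.ball x (δ x) :=
        Metric.ball_subset_ball (by nlinarith)
      refine (mul_le_mul_left (enorm_average_sub_rpow_le hu hp.le hσ (by positivity)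
        (hball.trans (ball_infDist_frontier_subset hopen hx))
        fun y hy ↦ (Metric.mem_ball'.1 (hball hy)).le) _).trans_eq ?_
      have hexp : (c / 2 * δ x) ^ (-(n : ℝ)) * δ x ^ σ * δ x ^ (-(s * p)) =
          (c / 2) ^ (-(n : ℝ)) := by
        rw [Real.mul_rpow (by positivity) hδx.le, mul_assoc, mul_assoc, ← Real.rpow_add hδx,
          ← Real.rpow_add hδx, hσ_def]
        ring_nf
        simp
      rw [inv_volume_ball x (by positivity), hdim, hK₃, ← hexp, ENNReal.ofReal_mul (by positivity),
        ENNReal.ofReal_mul (by positivity)]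
      ring
    have hfar : ‖m‖ₑ ^ p * ENNReal.ofReal (δ x ^ (-(s * p))) ≤
        K₁ * (ENNReal.ofReal (δ x ^ (-(n + ε))) *
          weightedEnergy G p σ ε u (Metric.ball x (6 * δ x))) := by
      have hexp : -(s * p) = (lam - ε) + -(n + ε) := by
        rw [hε_def]
        ring
      rw [hexp, Real.rpow_add hδx, ENNReal.ofReal_mul (by positivity), ← mul_assoc,
        mul_comm (ENNReal.ofReal (δ x ^ (-(n + ε)))), ← mul_assoc]
      exact mul_le_mul_left (havg u hu hsupp x hx) _
    rw [ENNReal.ofReal_rpow_of_pos hδx, div_eq_mul_inv,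
      ← ENNReal.ofReal_inv_of_pos (by positivity), ← Real.rpow_neg hδx.le]
    have htri : ‖u x‖ₑ ≤ ‖m - u x‖ₑ + ‖m‖ₑ := by
      rw [enorm_sub_rev]
      calc ‖u x‖ₑ = ‖(u x - m) + m‖ₑ := by rw [sub_add_cancel]
        _ ≤ _ := enorm_add_le _ _
    calc ‖u x‖ₑ ^ p * ENNReal.ofReal (δ x ^ (-(s * p)))
        ≤ (2 ^ (p - 1) * (‖m - u x‖ₑ ^ p + ‖m‖ₑ ^ p)) *
            ENNReal.ofReal (δ x ^ (-(s * p))) := by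
          gcongr
          exact (ENNReal.rpow_le_rpow htri hp₀).trans
            (ENNReal.rpow_add_le_mul_rpow_add_rpow _ _ hp.le)
      _ ≤ _ := by
          rw [mul_assoc, add_mul]
          gcongr
  calc ∫⁻ x in G, ‖u x‖ₑ ^ p / ENNReal.ofReal (δ x) ^ (s * p)
      ≤ ∫⁻ x in G, 2 ^ (p - 1) * (K₃ * g x + K₁ * (ENNReal.ofReal (δ x ^ (-(n + ε))) *
          weightedEnergy G p σ ε u (Metric.ball x (6 * δ x)))) :=
        setLIntegral_mono' hopen.measurableSet hpoint
    _ = 2 ^ (p - 1) * (K₃ * (∫⁻ x in G, g x) + K₁ * ∫⁻ x in G,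
          ENNReal.ofReal (δ x ^ (-(n + ε))) *
            weightedEnergy G p σ ε u (Metric.ball x (6 * δ x))) := by
        rw [lintegral_const_mul' _ _ (ENNReal.rpow_ne_top_of_nonneg (by linarith) (by simp)),
          lintegral_add_left (by fun_prop), lintegral_const_mul _ hg_meas,
          lintegral_const_mul' _ _ hK₁]
    _ ≤ 2 ^ (p - 1) * (K₃ * (∫⁻ x in G, g x) + K₁ * (K₂ * ∫⁻ x in G, g x)) := by
        gcongr
        exact hint u hu
    _ = K * ∫⁻ x in G, g x := by
        rw [hK]
        ring
    _ ≤ ENNReal.ofReal (K.toReal + 1) * ∫⁻ x in G, g x := by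
        gcongr
        rw [← ENNReal.ofReal_toReal hK_top]
        exact ENNReal.ofReal_le_ofReal (by simp)
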